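/- A *polygon tree* is a simple graph obtained recursively: a cycle is a polygon tree, and if $G$ is a polygon tree, then so is the graph obtained by picking an edge of $G$ and attaching a new cycle that shares exactly this edge (and its two end points) with $G$. A polygon tree is a *bipartite polygon tree* if all the cycles used in its construction are even. For a finite simple graph $G$ with vertex set $V$, the edge polytope $\mathcal P_G\subset\mathbb R^V$ is the convex hull of the vectors $\mathbf e_u+\mathbf e_v$ with $uv$ an edge of $G$, and its Ehrhart polynomial $i_G$ is the polynomial with $i_G(m)=|m\mathcal P_G\cap\mathbb Z^V|$ for all integers $m\ge 0$. For an integer $a$, let $S_a$ be the set of non-zero complex polynomials of the form $p(x)=v(x)\prod_{i=1}^{a}(x+i)$, where all roots of $v$ lie on the line $\operatorname{Re}x=-(a+1)/2$. **Proposition.** Let $G$ be a bipartite polygon tree with $e$ edges, constructed from $f_{2n}$ cycles with $2n$ edges for each $n\ge 2$. Then the Ehrhart polynomial $i_G$ exists and lies in $S_{e-1-\sum_n n f_{2n}}$. Consequently, every complex root of $i_G$ is a negative integer or lies on the line $\operatorname{Re}x=-\bigl(e-\sum_n n f_{2n}\bigr)/2$. -/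

import Mathlib

open scoped Pointwise

/-- `C` is a polygon (cycle) with `k` edges inside the simple graph `G`. -/
def IsPolygon {V : Type*} {G : SimpleGraph V} (C : G.Subgraph) (k : ℕ) : Prop :=
  ∃ (u : V) (w : G.Walk u u), w.IsCycle ∧ w.length = k ∧ C = w.toSubgraph

/-- `IsPolygonTree H s`: the subgraph `H` is a polygon tree, built from polygons whose numbers of
edges (with multiplicity) form the multiset `s`.  A polygon is a polygon tree; and if `H` is a
polygon tree and `C` is a polygon such that `H` and `C` have exactly an edge `uv` together with its
two end points in common, then the union of `H` and `C` is a polygon tree. -/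
inductive IsPolygonTree {V : Type*} {G : SimpleGraph V} : G.Subgraph → Multiset ℕ → Prop
  | polygon {C : G.Subgraph} {k : ℕ} (hC : IsPolygon C k) : IsPolygonTree C {k}
  | glue {H C : G.Subgraph} {s : Multiset ℕ} {k : ℕ} {u v : V}
      (hH : IsPolygonTree H s) (hC : IsPolygon C k)
      (huvH : H.Adj u v) (huvC : C.Adj u v) (hverts : H.verts ∩ C.verts = {u, v}) :
      IsPolygonTree (H ⊔ C) (k ::ₘ s)

/-- `G` is a bipartite polygon tree: the whole of `G` is a polygon tree all of whose constituent
polygons have an even number of edges, `f n` of them having `2 * n` edges. -/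
def IsBipartitePolygonTree {V : Type*} (G : SimpleGraph V) (f : ℕ →₀ ℕ) : Prop :=
  ∃ s : Multiset ℕ, IsPolygonTree (⊤ : G.Subgraph) s ∧ (∀ k ∈ s, Even k) ∧
    ∀ n, f n = s.count (2 * n)

/-- The vector `e_u + e_v` attached to the edge `uv`. -/
def edgeVector {V : Type*} [DecidableEq V] : Sym2 V → (V → ℝ) :=
  Sym2.lift ⟨fun u v => Pi.single u 1 + Pi.single v 1, fun _ _ => add_comm _ _⟩

/-- The edge polytope of `G`, the convex hull of the vectors of the edges. -/
def edgePolytope {V : Type*} [DecidableEq V] (G : SimpleGraph V) : Set (V → ℝ) :=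
  convexHull ℝ (edgeVector '' G.edgeSet)

/-- The number of integral points in the `m`-th dilate of the edge polytope. -/
noncomputable def ehrhartCount {V : Type*} [DecidableEq V] (G : SimpleGraph V) (m : ℕ) : ℕ :=
  {x : V → ℤ | (fun v => (x v : ℝ)) ∈ (m : ℝ) • edgePolytope G}.ncard

/-- `p` is the Ehrhart polynomial of the edge polytope of `G`.  (At most one polynomial is, as its
values at all natural numbers are prescribed; at `m = 0` the value is `1` if `G` has an edge.) -/
def IsEhrhartPolynomial {V : Type*} [DecidableEq V] (G : SimpleGraph V)
    (p : Polynomial ℚ) : Prop :=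
  ∀ m : ℕ, p.eval (m : ℚ) = (ehrhartCount G m : ℚ)

/-- The set `S_a` of the non-zero polynomials `v(x) (x + 1) ⋯ (x + a)` such that all the roots of
`v` lie on the line `Re x = -(a + 1) / 2`. -/
def rootSet (a : ℤ) : Set (Polynomial ℂ) :=
  {p | p ≠ 0 ∧ ∃ v : Polynomial ℂ,
    p = v * ∏ i ∈ Finset.Icc (1 : ℤ) a, (Polynomial.X + Polynomial.C (i : ℂ)) ∧
    ∀ z : ℂ, v.IsRoot z → z.re = -((a : ℝ) + 1) / 2}

/-! A lattice point of the `m`-th dilate is a vector of vertex sums of an edge weighting of total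
weight `m`, but many weightings give the same point. Each even polygon causes one redundancy: adding
and subtracting `t` alternately around it changes no vertex sum. For a polygon with `2n` edges, let
`A` be the `n` edges of the parity class that avoids the gluing edge. Subtracting the minimum on `A`
produces a zero there, and this normal form is unique. It also turns real weights with integral
vertex sums into natural ones (`HasReducedWeights.glue`). So the Ehrhart function counts the natural
weightings that vanish somewhere on each of the sets `A`, which are pairwise disjoint
(`HasReducedWeights.ehrhartCount_eq`).

Without any condition the count is `(e - 1 + m).choose m`, a polynomial in `S_{e-1}`. The weightings
positive on all of `A` correspond, by removing one unit from each element of `A`, to weightings of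
total `m - n`. Hence each condition replaces `p(x)` by `p(x) - p(x - n)`, which maps `S_a` to
`S_{a-n}` (`sub_comp_mem_rootSet`): away from the new critical line the two terms, stripped of
common factors, have different absolute values. Applying this once for each polygon gives the claim.
-/

/-! ### Backward differences and the location of roots. -/

lemma finset_prod_lt_prod_of_forall_lt {ι : Type*} {s : Finset ι} (hs : s.Nonempty) {f g : ι → ℝ}
    (h0 : ∀ i ∈ s, 0 ≤ f i) (h : ∀ i ∈ s, f i < g i) : ∏ i ∈ s, f i < ∏ i ∈ s, g i := by
  classical
  induction hs using Finset.Nonempty.cons_induction with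
  | singleton a => simpa using h a (by simp)
  | cons a s ha hs ih =>
    rw [Finset.prod_cons, Finset.prod_cons]
    exact mul_lt_mul'' (h a (by simp))
      (ih (fun i hi => h0 i (by simp [hi])) fun i hi => h i (by simp [hi]))
      (h0 a (by simp)) (Finset.prod_nonneg fun i hi => h0 i (by simp [hi]))

/-- Points with the same imaginary part are compared by the absolute values of the real parts. -/
lemma norm_lt_norm_of_im_eq {z w : ℂ} (him : z.im = w.im) (hre : z.re ^ 2 < w.re ^ 2) :
    ‖z‖ < ‖w‖ := by
  rw [Complex.norm_eq_sqrt_sq_add_sq, Complex.norm_eq_sqrt_sq_add_sq, him]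
  exact Real.sqrt_lt_sqrt (by positivity) (by linarith)

lemma norm_le_norm_of_im_eq {z w : ℂ} (him : z.im = w.im) (hre : z.re ^ 2 ≤ w.re ^ 2) :
    ‖z‖ ≤ ‖w‖ := by
  rw [Complex.norm_eq_sqrt_sq_add_sq, Complex.norm_eq_sqrt_sq_add_sq, him]
  exact Real.sqrt_le_sqrt (by linarith)

/-- Over `ℂ`, the absolute value at a point is that of the leading coefficient times the product of
the distances to the roots. -/
lemma norm_eval_le_norm_eval {v : Polynomial ℂ} {x y : ℂ}
    (h : ∀ z, v.IsRoot z → ‖x - z‖ ≤ ‖y - z‖) : ‖v.eval x‖ ≤ ‖v.eval y‖ := by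
  rcases eq_or_ne v 0 with rfl | hv
  · simp
  have key : ∀ t : ℂ, ‖v.eval t‖ = ‖v.leadingCoeff‖ * (v.roots.map fun z => ‖t - z‖).prod := by
    intro t
    conv_lhs => rw [(IsAlgClosed.splits v).eq_prod_roots]
    rw [Polynomial.eval_mul, Polynomial.eval_C, norm_mul, Polynomial.eval_multiset_prod]
    congr 1
    induction v.roots using Multiset.induction with
    | empty => simp
    | cons a m ih => simp [← ih]
  rw [key, key]
  refine mul_le_mul_of_nonneg_left ?_ (norm_nonneg _)
  refine Multiset.prod_map_le_prod_map₀ _ _ (fun _ _ => norm_nonneg _) fun z hz => h z ?_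
  exact (Polynomial.mem_roots hv).1 hz

/-- Reflecting the factors of a product in the line `Re x = -b / 2`. -/
lemma prod_Icc_eq_prod_reflect {a b n : ℤ} (hb : b = a - n + 1) (x : ℂ) :
    ∏ i ∈ Finset.Icc (1 - n) 0, (x + ((i : ℤ) : ℂ)) =
      ∏ i ∈ Finset.Icc b a, (x + ((b - i : ℤ) : ℂ)) := by
  refine Finset.prod_nbij' (fun i => b - i) (fun i => b - i) ?_ ?_ ?_ ?_ ?_ <;>
    simp <;> intros <;> omega

/-- The points `-i` and `i - b` are mirror images in the line `Re x = -b / 2`. Since `b - i ≤ 0 <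
i`, the point `-i` lies on the left, so to the right of the line every factor `x + i` exceeds its
partner. -/
lemma norm_prod_lt_norm_prod_right {a b n : ℤ} (hn : 1 ≤ n) (hb : b = a - n + 1) (hb1 : 1 ≤ b)
    {x : ℂ} (hx : 0 < 2 * x.re + b) :
    ‖∏ i ∈ Finset.Icc (1 - n) 0, (x + ((i : ℤ) : ℂ))‖ <
      ‖∏ i ∈ Finset.Icc b a, (x + ((i : ℤ) : ℂ))‖ := by
  rw [prod_Icc_eq_prod_reflect hb, norm_prod, norm_prod]
  refine finset_prod_lt_prod_of_forall_lt ⟨b, by simp; omega⟩ (fun _ _ => norm_nonneg _) ?_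
  intro i hi
  rw [Finset.mem_Icc] at hi
  have h1 : (b : ℝ) ≤ i := by exact_mod_cast hi.1
  have h2 : (1 : ℝ) ≤ b := by exact_mod_cast hb1
  refine norm_lt_norm_of_im_eq (by simp) ?_
  simp
  nlinarith

lemma norm_prod_lt_norm_prod_left {a b n : ℤ} (hn : 1 ≤ n) (hb : b = a - n + 1) (hb1 : 1 ≤ b)
    {x : ℂ} (hx : 2 * x.re + b < 0) :
    ‖∏ i ∈ Finset.Icc b a, (x + ((i : ℤ) : ℂ))‖ <
      ‖∏ i ∈ Finset.Icc (1 - n) 0, (x + ((i : ℤ) : ℂ))‖ := by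
  rw [prod_Icc_eq_prod_reflect hb, norm_prod, norm_prod]
  refine finset_prod_lt_prod_of_forall_lt ⟨b, by simp; omega⟩ (fun _ _ => norm_nonneg _) ?_
  intro i hi
  rw [Finset.mem_Icc] at hi
  have h1 : (b : ℝ) ≤ i := by exact_mod_cast hi.1
  have h2 : (1 : ℝ) ≤ b := by exact_mod_cast hb1
  refine norm_lt_norm_of_im_eq (by simp) ?_
  simp
  nlinarith

/-- The backward difference with step `n` maps `S_a` to `S_{a - n}`. -/
theorem sub_comp_mem_rootSet {a n : ℤ} {p : Polynomial ℂ} (hp : p ∈ rootSet a) (hn : 1 ≤ n)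
    (hna : n ≤ a) : p - p.comp (Polynomial.X - Polynomial.C (n : ℂ)) ∈ rootSet (a - n) := by
  obtain ⟨hp0, v, rfl, hv⟩ := hp
  obtain ⟨b, hb⟩ : ∃ b, b = a - n + 1 := ⟨_, rfl⟩
  have hb1 : 1 ≤ b := by omega
  set P : ℤ → ℤ → Polynomial ℂ := fun c d =>
    ∏ i ∈ Finset.Icc c d, (Polynomial.X + Polynomial.C (i : ℂ)) with hP
  have hbR : (b : ℝ) = a - n + 1 := by exact_mod_cast hb
  have hnR : (1 : ℝ) ≤ n := by exact_mod_cast hn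
  have hsplit1 : P 1 a = P b a * P 1 (a - n) := by
    have : Finset.Icc 1 a = Finset.Icc b a ∪ Finset.Icc 1 (a - n) := by
      ext; simp; omega
    rw [hP]
    simp only
    rw [this, Finset.prod_union]
    rw [Finset.disjoint_left]; simp; intros; omega
  have hsplit2 : (P 1 a).comp (Polynomial.X - Polynomial.C (n : ℂ)) = P (1 - n) 0 * P 1 (a - n) := by
    have : Finset.Icc (1 - n) (a - n) = Finset.Icc (1 - n) 0 ∪ Finset.Icc 1 (a - n) := by
      ext; simp; omega
    rw [hP]
    simp only
    rw [← Finset.prod_union, ← this, Polynomial.prod_comp]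
    · refine Finset.prod_nbij' (fun i => i - n) (fun i => i + n) ?_ ?_ ?_ ?_ ?_ <;> simp <;>
        intros <;> first | omega | ring
    · rw [Finset.disjoint_left]; simp; intros; omega
  set w : Polynomial ℂ := v * P b a - v.comp (Polynomial.X - Polynomial.C (n : ℂ)) * P (1 - n) 0
  have hfac : v * P 1 a - (v * P 1 a).comp (Polynomial.X - Polynomial.C (n : ℂ)) =
      w * P 1 (a - n) := by
    rw [Polynomial.mul_comp, hsplit2, hsplit1]; ring
  have hw : ∀ z : ℂ, w.eval z = v.eval z * ∏ i ∈ Finset.Icc b a, (z + ((i : ℤ) : ℂ)) -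
      v.eval (z - n) * ∏ i ∈ Finset.Icc (1 - n) 0, (z + ((i : ℤ) : ℂ)) := by
    intro z
    simp [w, hP, Polynomial.eval_prod]
  -- The points `z` and `z - n` are equidistant from the line `Re x = -(a + 1) / 2` containing the
  -- roots of `v` exactly when `Re z = -b / 2`. So the comparison of the values of `v` and that of
  -- the linear products change direction at the same line, and off it the two terms of `w` cannot
  -- cancel.
  have hroot : ∀ z : ℂ, w.IsRoot z → 2 * z.re + b = 0 := by
    intro z hz
    rw [Polynomial.IsRoot, hw, sub_eq_zero] at hz
    have hz' := congrArg norm hz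
    rw [norm_mul, norm_mul] at hz'
    rcases lt_trichotomy (2 * z.re + b) 0 with h | h | h
    · exfalso
      have h1 : ‖v.eval z‖ ≤ ‖v.eval (z - n)‖ := norm_eval_le_norm_eval fun r hr => by
        refine norm_le_norm_of_im_eq (by simp) ?_
        have := hv r hr
        simp
        nlinarith
      -- Needed for strictness: a root of `v` at `z - n` would give `2 * z.re + b = n > 0`.
      have h2 : 0 < ‖v.eval (z - n)‖ := by
        rw [norm_pos_iff]
        intro h0
        have := hv _ h0
        simp at this
        nlinarith
      have h3 := norm_prod_lt_norm_prod_left hn hb hb1 h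
      nlinarith [mul_le_mul_of_nonneg_right h1
        (norm_nonneg (∏ i ∈ Finset.Icc b a, (z + ((i : ℤ) : ℂ)))),
        mul_lt_mul_of_pos_left h3 h2]
    · exact h
    · exfalso
      have h1 : ‖v.eval (z - n)‖ ≤ ‖v.eval z‖ := norm_eval_le_norm_eval fun r hr => by
        refine norm_le_norm_of_im_eq (by simp) ?_
        have := hv r hr
        simp
        nlinarith
      have h2 : 0 < ‖v.eval z‖ := by
        rw [norm_pos_iff]
        intro h0
        have := hv _ h0
        nlinarith
      have h3 := norm_prod_lt_norm_prod_right hn hb hb1 h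
      nlinarith [mul_le_mul_of_nonneg_right h1
        (norm_nonneg (∏ i ∈ Finset.Icc (1 - n) 0, (z + ((i : ℤ) : ℂ)))),
        mul_lt_mul_of_pos_left h3 h2]
  refine ⟨?_, w, hfac, fun z hz => ?_⟩
  · change v * P 1 a - (v * P 1 a).comp _ ≠ 0
    rw [hfac]
    refine mul_ne_zero ?_ ?_
    -- If `w` were zero, every point would be a root, including `0`, which is off the line because
    -- `b ≥ 1`.
    · intro h0
      have := hroot 0 (by simp [h0])
      simp at this
      omega
    · exact Finset.prod_ne_zero_iff.2 fun i _ => Polynomial.X_add_C_ne_zero _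
  · have := hroot z hz
    push_cast
    linarith

/-! ### Counting reduced weights. -/

/-- The weights on `E` of total weight `m` that vanish somewhere on each member of `L`. -/
def reducedWeights {α : Type*} [DecidableEq α] (E : Finset α) (L : List (Finset α)) (m : ℕ) :
    Finset (α → ℕ) :=
  (E.piAntidiag m).filter fun w => ∀ A ∈ L, ∃ a ∈ A, w a = 0

lemma mem_reducedWeights {α : Type*} [DecidableEq α] {E : Finset α} {L : List (Finset α)} {m : ℕ}
    {w : α → ℕ} : w ∈ reducedWeights E L m ↔
      (∑ e ∈ E, w e = m ∧ ∀ e, w e ≠ 0 → e ∈ E) ∧ ∀ A ∈ L, ∃ a ∈ A, w a = 0 := by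
  simp [reducedWeights]

lemma card_piAntidiag_eq_choose {α : Type*} [DecidableEq α] (E : Finset α) (m : ℕ) :
    (E.piAntidiag m).card = (E.card + m - 1).choose m := by
  rw [← Finset.card_finsuppAntidiag_nat_eq_choose, Finset.finsuppAntidiag, Finset.card_map,
    Finset.card_attach]

/-- Removing one unit of weight on each element of `A`. -/
lemma card_filter_forall_ne_zero {α : Type*} [DecidableEq α] {E A : Finset α}
    {L : List (Finset α)} (hA : A ⊆ E) (hL : ∀ B ∈ L, Disjoint A B) (m : ℕ) :
    ((reducedWeights E L (m + A.card)).filter fun w => ∀ a ∈ A, w a ≠ 0).card =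
      (reducedWeights E L m).card := by
  have hsum : ∑ e ∈ E, (if e ∈ A then 1 else 0) = A.card := by
    rw [← Finset.sum_filter, Finset.sum_const, smul_eq_mul, mul_one,
      Finset.filter_mem_eq_inter, Finset.inter_eq_right.2 hA]
  refine Finset.card_nbij' (fun w e => w e - if e ∈ A then 1 else 0)
    (fun w e => w e + if e ∈ A then 1 else 0) ?_ ?_ ?_ ?_
  · intro w hw
    simp only [Finset.coe_filter, Set.mem_ofPred_eq, mem_reducedWeights] at hw
    obtain ⟨⟨⟨h1, h2⟩, h3⟩, h4⟩ := hw
    rw [Finset.mem_coe, mem_reducedWeights]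
    refine ⟨⟨?_, fun e he => h2 e (by intro h; simp [h] at he)⟩, fun B hB => ?_⟩
    · have : ∑ e ∈ E, (w e - if e ∈ A then 1 else 0) + ∑ e ∈ E, (if e ∈ A then 1 else 0) =
          ∑ e ∈ E, w e := by
        rw [← Finset.sum_add_distrib]
        refine Finset.sum_congr rfl fun e _ => ?_
        split_ifs with h
        · have := h4 e h; omega
        · simp
      simp only
      omega
    · obtain ⟨b, hb, hb0⟩ := h3 B hB
      exact ⟨b, hb, by simp [hb0]⟩
  · intro w hw
    rw [Finset.mem_coe, mem_reducedWeights] at hw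
    obtain ⟨⟨h1, h2⟩, h3⟩ := hw
    simp only [Finset.coe_filter, Set.mem_ofPred_eq, mem_reducedWeights]
    refine ⟨⟨⟨by rw [Finset.sum_add_distrib, h1, hsum], fun e he => ?_⟩, fun B hB => ?_⟩,
      fun a ha => by simp [ha]⟩
    · by_cases h : e ∈ A
      · exact hA h
      · exact h2 e (by simpa [h] using he)
    · obtain ⟨b, hb, hb0⟩ := h3 B hB
      have : b ∉ A := fun h => Finset.disjoint_left.1 (hL B hB) h hb
      exact ⟨b, hb, by simp [hb0, this]⟩
  · intro w hw
    simp only [Finset.coe_filter, Set.mem_ofPred_eq, mem_reducedWeights] at hw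
    funext e
    by_cases h : e ∈ A
    · have := hw.2 e h
      simp [h]; omega
    · simp [h]
  · intro w hw
    funext e
    simp

/-- Weights either vanish somewhere on `A` or are positive on all of it; the latter are counted by
removing a unit along `A`. -/
lemma card_reducedWeights_cons {α : Type*} [DecidableEq α] {E A : Finset α}
    {L : List (Finset α)} (hA : A ⊆ E) (hL : ∀ B ∈ L, Disjoint A B) (m : ℕ) :
    (reducedWeights E (A :: L) (m + A.card)).card + (reducedWeights E L m).card =
      (reducedWeights E L (m + A.card)).card := by
  rw [← card_filter_forall_ne_zero hA hL,
    ← Finset.card_filter_add_card_filter_not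
      (s := reducedWeights E L (m + A.card)) (fun w => ∃ a ∈ A, w a = 0)]
  congr 2
  · ext w; simp [mem_reducedWeights]; tauto
  · ext w; simp

lemma reducedWeights_cons_of_lt {α : Type*} [DecidableEq α] {E A : Finset α}
    {L : List (Finset α)} (hA : A ⊆ E) {m : ℕ} (hm : m < A.card) :
    reducedWeights E (A :: L) m = reducedWeights E L m := by
  ext w
  simp only [mem_reducedWeights, List.mem_cons, forall_eq_or_imp]
  refine ⟨fun h => ⟨h.1, h.2.2⟩, fun h => ⟨h.1, ?_, h.2⟩⟩
  by_contra! hc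
  have h1 : A.card ≤ ∑ a ∈ A, w a := by
    rw [Finset.card_eq_sum_ones]
    exact Finset.sum_le_sum fun a ha => Nat.one_le_iff_ne_zero.2 (hc a ha)
  have h2 : ∑ a ∈ A, w a ≤ ∑ a ∈ E, w a := Finset.sum_le_sum_of_subset hA
  omega

lemma eval_eq_zero_of_mem_rootSet {a : ℤ} {p : Polynomial ℚ}
    (hp : p.map (algebraMap ℚ ℂ) ∈ rootSet a) {i : ℤ} (h1 : 1 ≤ i) (h2 : i ≤ a) :
    p.eval (-(i : ℚ)) = 0 := by
  obtain ⟨-, v, hv, -⟩ := hp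
  have h : (p.map (algebraMap ℚ ℂ)).eval (algebraMap ℚ ℂ (-(i : ℚ))) = 0 := by
    rw [hv, Polynomial.eval_mul, Polynomial.eval_prod,
      Finset.prod_eq_zero (Finset.mem_Icc.2 ⟨h1, h2⟩) (by simp), mul_zero]
  rw [Polynomial.eval_map, Polynomial.eval₂_at_apply] at h
  exact (map_eq_zero _).1 h

lemma exists_polynomial_choose (k : ℕ) :
    ∃ p : Polynomial ℚ, p.map (algebraMap ℚ ℂ) ∈ rootSet k ∧
      ∀ m : ℕ, p.eval (m : ℚ) = ((k + m).choose m : ℚ) := by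
  have hk : ((k.factorial : ℕ) : ℂ) ≠ 0 := by exact_mod_cast k.factorial_ne_zero
  have hIcc : Finset.Icc (1 : ℤ) k = (Finset.range k).image fun i : ℕ => (i : ℤ) + 1 := by
    ext x
    simp only [Finset.mem_Icc, Finset.mem_image, Finset.mem_range]
    exact ⟨fun h => ⟨(x - 1).toNat, by omega, by omega⟩, by rintro ⟨i, hi, rfl⟩; omega⟩
  refine ⟨Polynomial.C ((k.factorial : ℚ)⁻¹) *
    ∏ i ∈ Finset.Icc (1 : ℤ) k, (Polynomial.X + Polynomial.C (i : ℚ)), ?_, fun m => ?_⟩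
  · have hmap : Polynomial.map (algebraMap ℚ ℂ) (Polynomial.C ((k.factorial : ℚ)⁻¹) *
        ∏ i ∈ Finset.Icc (1 : ℤ) k, (Polynomial.X + Polynomial.C (i : ℚ))) =
        Polynomial.C ((k.factorial : ℂ)⁻¹) *
          ∏ i ∈ Finset.Icc (1 : ℤ) k, (Polynomial.X + Polynomial.C (i : ℂ)) := by
      simp [Polynomial.map_prod]
    rw [hmap]
    refine ⟨mul_ne_zero ?_ (Finset.prod_ne_zero_iff.2 fun i _ => Polynomial.X_add_C_ne_zero _),
      _, rfl, fun z hz => ?_⟩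
    · simpa using hk
    · simp [Polynomial.IsRoot, k.factorial_ne_zero] at hz
  · rw [Polynomial.eval_mul, Polynomial.eval_prod, Polynomial.eval_C, hIcc,
      Finset.prod_image (by intro a _ b _ h; simpa using h), inv_mul_eq_iff_eq_mul₀ (by positivity)]
    have h : ((m + 1).ascFactorial k : ℚ) = k.factorial * (k + m).choose m := by
      rw [Nat.ascFactorial_eq_factorial_mul_choose, Nat.add_comm m k, Nat.choose_symm_add]
      push_cast; ring
    rw [← h, Nat.ascFactorial_eq_prod_range]
    push_cast
    exact Finset.prod_congr rfl fun i _ => by simp; ring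

/-- Induction on `L`: each new set `A` applies the backward difference with step `A.card`, and `hlt`
keeps the step within the range that `sub_comp_mem_rootSet` allows. -/
theorem exists_polynomial_card_reducedWeights {α : Type*} [DecidableEq α] {E : Finset α}
    {L : List (Finset α)} (hL : ∀ A ∈ L, A ⊆ E ∧ A.Nonempty) (hdisj : L.Pairwise Disjoint)
    (hlt : (L.map Finset.card).sum < E.card) :
    ∃ p : Polynomial ℚ,
      p.map (algebraMap ℚ ℂ) ∈ rootSet ((E.card : ℤ) - 1 - (L.map Finset.card).sum) ∧
      ∀ m : ℕ, p.eval (m : ℚ) = ((reducedWeights E L m).card : ℚ) := by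
  induction L with
  | nil =>
    obtain ⟨p, hp, hpm⟩ := exists_polynomial_choose (E.card - 1)
    simp only [List.map_nil, List.sum_nil] at hlt
    refine ⟨p, ?_, fun m => ?_⟩
    · rwa [List.map_nil, List.sum_nil, Nat.cast_zero, sub_zero,
        show (E.card : ℤ) - 1 = ((E.card - 1 : ℕ) : ℤ) by omega]
    · rw [hpm]
      have : reducedWeights E [] m = E.piAntidiag m := by simp [reducedWeights]
      rw [this, card_piAntidiag_eq_choose]
      congr 2
      omega
  | cons A L ih =>
    rw [List.map_cons, List.sum_cons] at hlt ⊢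
    rw [List.pairwise_cons] at hdisj
    obtain ⟨hA, hAne⟩ := hL A (by simp)
    have hcard := hAne.card_pos
    obtain ⟨p, hp, hpm⟩ := ih (fun B hB => hL B (by simp [hB])) hdisj.2 (by omega)
    refine ⟨p - p.comp (Polynomial.X - Polynomial.C (A.card : ℚ)), ?_, fun m => ?_⟩
    · have := sub_comp_mem_rootSet (n := (A.card : ℤ)) hp (by omega) (by omega)
      rw [Nat.cast_add, add_comm (A.card : ℤ), ← sub_sub]
      simpa [Polynomial.map_comp] using this
    · rw [Polynomial.eval_sub, Polynomial.eval_comp, hpm]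
      simp only [Polynomial.eval_sub, Polynomial.eval_X, Polynomial.eval_C]
      rcases lt_or_ge m A.card with h | h
      -- For `m < A.card` the polynomial is evaluated at the negative integer `m - A.card`. By `hlt`
      -- this is one of the forced roots, in agreement with the count: a total weight of `m` cannot
      -- be positive on all of `A`.
      · have h0 := eval_eq_zero_of_mem_rootSet hp (i := (A.card : ℤ) - m) (by omega) (by omega)
        push_cast at h0
        rw [neg_sub] at h0
        rw [h0, reducedWeights_cons_of_lt hA h, sub_zero]
      · obtain ⟨l, rfl⟩ := Nat.exists_eq_add_of_le' h
        rw [← card_reducedWeights_cons hA hdisj.1]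
        push_cast
        rw [add_sub_cancel_right, hpm]
        ring

/-! ### Vertex sums and normal forms of edge weights. -/

/-- The total weight of the edges in `E` at the vertex `x`. -/
def vertexSum {V R : Type*} [DecidableEq V] [AddCommMonoid R] (E : Finset (Sym2 V))
    (w : Sym2 V → R) (x : V) : R :=
  ∑ e ∈ E, if x ∈ e then w e else 0

/-- `L` selects exactly one representative among the natural edge weights on `E` with given sums at
the vertices, and every nonnegative real weight with integral vertex sums can be replaced by such
a representative. -/
structure HasReducedWeights {V : Type*} [DecidableEq V] (E : Finset (Sym2 V))
    (L : List (Finset (Sym2 V))) : Prop where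
  subset_nonempty : ∀ A ∈ L, A ⊆ E ∧ A.Nonempty
  pairwise_disjoint : L.Pairwise Disjoint
  sum_card_lt : (L.map Finset.card).sum < E.card
  exists_nat : ∀ w : Sym2 V → ℝ, (∀ e ∈ E, 0 ≤ w e) → (∀ x, ∃ z : ℤ, vertexSum E w x = z) →
    ∃ w' : Sym2 V → ℕ, (∀ A ∈ L, ∃ a ∈ A, w' a = 0) ∧
      ∀ x, vertexSum E (fun e => (w' e : ℝ)) x = vertexSum E w x
  unique : ∀ w w' : Sym2 V → ℕ, (∀ A ∈ L, ∃ a ∈ A, w a = 0) → (∀ A ∈ L, ∃ a ∈ A, w' a = 0) →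
    (∀ x, vertexSum E w x = vertexSum E w' x) → ∀ e ∈ E, w e = w' e

/-- Base of the construction: the weight of a lone edge is its vertex sum at either end, so no
reduction is needed. -/
lemma hasReducedWeights_singleton {V : Type*} [DecidableEq V] (e : Sym2 V) :
    HasReducedWeights {e} [] where
  subset_nonempty := by simp
  pairwise_disjoint := List.Pairwise.nil
  sum_card_lt := by simp
  exists_nat w hw hz := by
    induction e using Sym2.ind with | _ u v
    obtain ⟨z, hz⟩ := hz u
    simp [vertexSum] at hz
    have h0 := hw s(u, v) (by simp)
    rw [hz] at h0
    refine ⟨fun _ => z.toNat, by simp, fun x => ?_⟩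
    lift z to ℕ using by exact_mod_cast h0
    simp [vertexSum, hz]
  unique w w' _ _ h := by
    induction e using Sym2.ind with | _ u v
    simpa [vertexSum] using h u

/-! ### Gluing a path of odd length to an edge. -/

/-- The `i`-th edge of the walk `g 0, g 1, …`. -/
def pathEdge {V : Type*} (g : ℕ → V) (i : ℕ) : Sym2 V := s(g i, g (i + 1))

lemma mem_pathEdge {V : Type*} {g : ℕ → V} {i : ℕ} {x : V} :
    x ∈ pathEdge g i ↔ x = g i ∨ x = g (i + 1) := by
  simp [pathEdge]

lemma pathEdge_injOn {V : Type*} {g : ℕ → V} {K : ℕ} (hg : Set.InjOn g (Set.Iic K)) :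
    Set.InjOn (pathEdge g) (Set.Iio K) := by
  intro i hi j hj h
  simp only [Set.mem_Iio] at hi hj
  rw [pathEdge, pathEdge, Sym2.eq_iff] at h
  rcases h with ⟨h, -⟩ | ⟨h1, h2⟩
  · exact hg (by simp; omega) (by simp; omega) h
  · have := hg (by simp; omega) (by simp; omega) h1
    have := hg (by simp; omega) (by simp; omega) h2
    omega

lemma card_image_pathEdge_even {V : Type*} [DecidableEq V] {g : ℕ → V} {N : ℕ}
    (hg : Set.InjOn g (Set.Iic (2 * N + 1))) :
    ((Finset.range (N + 1)).image (fun i => pathEdge g (2 * i))).card = N + 1 := by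
  rw [Finset.card_image_of_injOn, Finset.card_range]
  intro i hi j hj hij
  simp only [Finset.coe_range, Set.mem_Iio] at hi hj
  have := pathEdge_injOn hg (by simp; omega) (by simp; omega) hij
  omega

lemma pathEdge_notMem {V : Type*} {g : ℕ → V} {K : ℕ} (hK : 2 ≤ K) {E : Finset (Sym2 V)}
    (hE : ∀ i, 0 < i → i < K → ∀ e ∈ E, g i ∉ e) {i : ℕ} (hi : i < K) : pathEdge g i ∉ E := by
  intro h
  rcases Nat.eq_zero_or_pos i with rfl | h0
  · exact hE 1 (by omega) (by omega) _ h (by simp [pathEdge])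
  · exact hE i h0 hi _ h (by simp [pathEdge])

lemma vertexSum_union_path {V R : Type*} [DecidableEq V] [AddCommMonoid R] {g : ℕ → V} {K : ℕ}
    (hg : Set.InjOn g (Set.Iic K)) {E : Finset (Sym2 V)} (hE : ∀ i < K, pathEdge g i ∉ E)
    (w : Sym2 V → R) (x : V) :
    vertexSum (E ∪ (Finset.range K).image (pathEdge g)) w x =
      vertexSum E w x + ∑ i ∈ Finset.range K, if x ∈ pathEdge g i then w (pathEdge g i) else 0 := by
  rw [vertexSum, Finset.sum_union, Finset.sum_image, vertexSum]
  · intro i hi j hj h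
    exact pathEdge_injOn hg (by simpa using hi) (by simpa using hj) h
  · rw [Finset.disjoint_left]
    intro e he h
    obtain ⟨i, hi, rfl⟩ := Finset.mem_image.1 h
    exact hE i (Finset.mem_range.1 hi) he

lemma sum_path_interior {V R : Type*} [DecidableEq V] [AddCommMonoid R] {g : ℕ → V} {K : ℕ}
    (hg : Set.InjOn g (Set.Iic K)) {j : ℕ} (hj : j + 1 < K) (c : ℕ → R) :
    ∑ i ∈ Finset.range K, (if g (j + 1) ∈ pathEdge g i then c i else 0) = c j + c (j + 1) := by
  have : ∀ i ∈ Finset.range K, (if g (j + 1) ∈ pathEdge g i then c i else 0) =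
      (if j = i then c i else 0) + if j + 1 = i then c i else 0 := by
    intro i hi
    rw [Finset.mem_range] at hi
    have h1 : g (j + 1) = g i ↔ j + 1 = i := hg.eq_iff (by simp; omega) (by simp; omega)
    have h2 : g (j + 1) = g (i + 1) ↔ j + 1 = i + 1 := hg.eq_iff (by simp; omega) (by simp; omega)
    simp only [mem_pathEdge, h1, h2]
    by_cases ha : j = i
    · subst ha; simp
    · by_cases hb : j + 1 = i <;> simp [ha, hb]
  rw [Finset.sum_congr rfl this, Finset.sum_add_distrib, Finset.sum_ite_eq, Finset.sum_ite_eq,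
    if_pos (by simp; omega), if_pos (by simpa using hj)]

/-- The contributions at `x` telescope along the path. What is left at the two ends is cancelled by
the closing edge because the path has odd length. -/
lemma sum_path_alternating {V : Type*} [DecidableEq V] {g : ℕ → V} {N : ℕ}
    (hg : Set.InjOn g (Set.Iic (2 * N + 1))) (t : ℝ) (x : V) :
    ∑ i ∈ Finset.range (2 * N + 1), (if x ∈ pathEdge g i then (-1) ^ (i + 1) * t else 0) +
      (if x ∈ s(g 0, g (2 * N + 1)) then t else 0) = 0 := by
  have h1 : ∀ i ∈ Finset.range (2 * N + 1), (if x ∈ pathEdge g i then (-1) ^ (i + 1) * t else 0) =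
      ((-1) ^ (i + 1) * if x = g (i + 1) then t else 0) - (-1) ^ i * if x = g i then t else 0 := by
    intro i hi
    rw [Finset.mem_range] at hi
    have hne : g i ≠ g (i + 1) := fun h => by
      have := hg (by simp; omega) (by simp; omega) h
      omega
    simp only [mem_pathEdge]
    by_cases ha : x = g i
    · subst ha
      simp [hne, pow_succ]
    · by_cases hb : x = g (i + 1) <;> simp [ha, hb, hne.symm]
  have hne : g 0 ≠ g (2 * N + 1) := fun h => by
    have := hg (by simp) (by simp) h
    omega
  rw [Finset.sum_congr rfl h1,
    Finset.sum_range_sub (fun i => (-1) ^ i * if x = g i then t else 0)]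
  simp only [Sym2.mem_iff]
  by_cases ha : x = g 0
  · subst ha
    simp [hne]
  · by_cases hb : x = g (2 * N + 1) <;> simp [ha, hb, pow_succ, hne.symm]

lemma exists_extend_along_path {V : Type*} {g : ℕ → V} {K : ℕ}
    (hg : Set.InjOn g (Set.Iic K)) {E : Finset (Sym2 V)} (hE : ∀ i < K, pathEdge g i ∉ E)
    (w : Sym2 V → ℕ) (c : ℕ → ℕ) :
    ∃ w' : Sym2 V → ℕ, (∀ e ∈ E, w' e = w e) ∧ ∀ i < K, w' (pathEdge g i) = c i := by
  classical
  refine ⟨fun e => if e ∈ E then w e else c (Function.invFunOn (pathEdge g) (Set.Iio K) e),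
    fun e he => by simp [he], fun i hi => ?_⟩
  simp only [hE i hi, if_false]
  rw [(pathEdge_injOn hg).leftInvOn_invFunOn hi]

lemma vertexSum_congr {V R : Type*} [DecidableEq V] [AddCommMonoid R] {E : Finset (Sym2 V)}
    {w w' : Sym2 V → R} (h : ∀ e ∈ E, w e = w' e) (x : V) : vertexSum E w x = vertexSum E w' x :=
  Finset.sum_congr rfl fun e he => by rw [h e he]

lemma vertexSum_eq_zero {V R : Type*} [DecidableEq V] [AddCommMonoid R] {E : Finset (Sym2 V)}
    {x : V} (h : ∀ e ∈ E, x ∉ e) (w : Sym2 V → R) : vertexSum E w x = 0 :=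
  Finset.sum_eq_zero fun e he => if_neg (h e he)

lemma vertexSum_add_single {V R : Type*} [DecidableEq V] [AddCommMonoid R] {E : Finset (Sym2 V)}
    {e₀ : Sym2 V} (he₀ : e₀ ∈ E) (w : Sym2 V → R) (t : R) (x : V) :
    vertexSum E (fun e => w e + if e = e₀ then t else 0) x =
      vertexSum E w x + if x ∈ e₀ then t else 0 := by
  have : ∀ e ∈ E, (if x ∈ e then w e + (if e = e₀ then t else 0) else 0) =
      (if x ∈ e then w e else 0) + if e = e₀ then (if x ∈ e₀ then t else 0) else 0 := by
    intro e _
    by_cases h : e = e₀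
    · subst h; by_cases hx : x ∈ e <;> simp [hx]
    · simp [h]
  rw [vertexSum, Finset.sum_congr rfl this, Finset.sum_add_distrib, Finset.sum_ite_eq',
    if_pos he₀, vertexSum]

/-- Gluing a polygon with `2 * N + 2` edges along an edge of `E`. -/
theorem HasReducedWeights.glue {V : Type*} [DecidableEq V] {E : Finset (Sym2 V)}
    {L : List (Finset (Sym2 V))} (h : HasReducedWeights E L) {g : ℕ → V} {N : ℕ} (hN : 1 ≤ N)
    (hg : Set.InjOn g (Set.Iic (2 * N + 1)))
    (hE : ∀ i, 0 < i → i < 2 * N + 1 → ∀ e ∈ E, g i ∉ e) (he : s(g 0, g (2 * N + 1)) ∈ E) :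
    HasReducedWeights (E ∪ (Finset.range (2 * N + 1)).image (pathEdge g))
      ((Finset.range (N + 1)).image (fun i => pathEdge g (2 * i)) :: L) := by
  have hpE : ∀ i < 2 * N + 1, pathEdge g i ∉ E := fun i hi => pathEdge_notMem (by omega) hE hi
  have hinj := pathEdge_injOn hg
  have hcardP : ((Finset.range (2 * N + 1)).image (pathEdge g)).card = 2 * N + 1 := by
    rw [Finset.card_image_of_injOn (by simpa using hinj), Finset.card_range]
  have hdisj : Disjoint E ((Finset.range (2 * N + 1)).image (pathEdge g)) := by
    rw [Finset.disjoint_left]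
    intro e he h
    obtain ⟨i, hi, rfl⟩ := Finset.mem_image.1 h
    exact hpE i (Finset.mem_range.1 hi) he
  have hAP : (Finset.range (N + 1)).image (fun i => pathEdge g (2 * i)) ⊆
      (Finset.range (2 * N + 1)).image (pathEdge g) := by
    intro e he
    obtain ⟨i, hi, rfl⟩ := Finset.mem_image.1 he
    rw [Finset.mem_range] at hi
    exact Finset.mem_image_of_mem _ (by simp; omega)
  refine ⟨?_, ?_, ?_, ?_, ?_⟩
  · intro A hA
    rcases List.mem_cons.1 hA with rfl | hA
    · exact ⟨hAP.trans Finset.subset_union_right, by simp⟩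
    · exact ⟨(h.subset_nonempty A hA).1.trans Finset.subset_union_left, (h.subset_nonempty A hA).2⟩
  · refine List.pairwise_cons.2 ⟨fun A hA => ?_, h.pairwise_disjoint⟩
    exact (hdisj.mono (h.subset_nonempty A hA).1 hAP).symm
  -- The left side grows by `N + 1`, the right side by `2 * N + 1`.
  · rw [List.map_cons, List.sum_cons, card_image_pathEdge_even hg,
      Finset.card_union_of_disjoint hdisj, hcardP]
    have := h.sum_card_lt
    omega
  · intro w hw hz
    obtain ⟨i₀, hi₀, hmin⟩ := Finset.exists_min_image (Finset.range (N + 1))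
      (fun i => w (pathEdge g (2 * i))) ⟨0, by simp⟩
    rw [Finset.mem_range] at hi₀
    -- The largest admissible shift: `t` is subtracted on the even path edges and added on the odd
    -- ones and on the gluing edge. All weights stay nonnegative, and edge `2 * i₀` gets weight
    -- zero.
    set t := w (pathEdge g (2 * i₀)) with ht
    have hmem : ∀ i < 2 * N + 1, pathEdge g i ∈ E ∪ (Finset.range (2 * N + 1)).image (pathEdge g) :=
      fun i hi => Finset.mem_union_right _ (Finset.mem_image_of_mem _ (by simpa using hi))
    have ht0 : 0 ≤ t := hw _ (hmem _ (by omega))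
    set wE : Sym2 V → ℝ := fun e => w e + if e = s(g 0, g (2 * N + 1)) then t else 0 with hwE
    set c : ℕ → ℝ := fun i => w (pathEdge g i) + (-1) ^ (i + 1) * t with hc
    have hshift : ∀ x, vertexSum (E ∪ (Finset.range (2 * N + 1)).image (pathEdge g)) w x =
        vertexSum E wE x + ∑ i ∈ Finset.range (2 * N + 1), if x ∈ pathEdge g i then c i else 0 := by
      intro x
      have hsplit : ∑ i ∈ Finset.range (2 * N + 1), (if x ∈ pathEdge g i then c i else 0) =
          ∑ i ∈ Finset.range (2 * N + 1), (if x ∈ pathEdge g i then w (pathEdge g i) else 0) +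
          ∑ i ∈ Finset.range (2 * N + 1),
            (if x ∈ pathEdge g i then (-1) ^ (i + 1) * t else 0) := by
        rw [← Finset.sum_add_distrib]
        refine Finset.sum_congr rfl fun i _ => ?_
        split_ifs <;> simp [hc]
      have := sum_path_alternating hg t x
      rw [vertexSum_union_path hg hpE, vertexSum_add_single he, hsplit]
      linarith
    have hc0 : ∀ i < 2 * N + 1, 0 ≤ c i := by
      intro i hi
      rcases Nat.even_or_odd' i with ⟨j, rfl | rfl⟩
      · have := hmin j (by simp; omega)
        simp only [hc, pow_succ, pow_mul]
        norm_num
        exact this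
      · have := hw _ (hmem _ hi)
        simp only [hc, pow_succ, pow_mul]
        norm_num
        positivity
    -- An interior path vertex lies on just two edges, so the shifted weights of consecutive path
    -- edges have an integral sum. Integrality therefore spreads along the path from the zero at `2
    -- * i₀`.
    have hstep : ∀ i, i + 1 < 2 * N + 1 → ((∃ z : ℤ, c i = z) ↔ ∃ z : ℤ, c (i + 1) = z) := by
      intro i hi
      obtain ⟨z, hz⟩ := hz (g (i + 1))
      rw [hshift, vertexSum_eq_zero (hE (i + 1) (by omega) hi), sum_path_interior hg hi,
        zero_add] at hz
      constructor
      · rintro ⟨y, hy⟩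
        exact ⟨z - y, by push_cast; linarith⟩
      · rintro ⟨y, hy⟩
        exact ⟨z - y, by push_cast; linarith⟩
    have hall : ∀ i < 2 * N + 1, ((∃ z : ℤ, c 0 = z) ↔ ∃ z : ℤ, c i = z) := by
      intro i
      induction i with
      | zero => simp
      | succ i ih => exact fun hi => (ih (by omega)).trans (hstep i hi)
    have hci₀ : c (2 * i₀) = 0 := by
      simp only [hc, pow_succ, pow_mul, ← ht]
      norm_num
    have hc1 : ∃ z : ℤ, c 0 = z := (hall (2 * i₀) (by omega)).2 ⟨0, by simp [hci₀]⟩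
    have hnat : ∀ i, ∃ k : ℕ, i < 2 * N + 1 → c i = k := by
      intro i
      by_cases hi : i < 2 * N + 1
      · obtain ⟨z, hz⟩ := (hall i hi).1 hc1
        have h0 := hc0 i hi
        rw [hz] at h0
        lift z to ℕ using by exact_mod_cast h0
        exact ⟨z, fun _ => by simpa using hz⟩
      · exact ⟨0, fun h => absurd h hi⟩
    choose k hk using hnat
    have hsumk : ∀ x, ∑ i ∈ Finset.range (2 * N + 1), (if x ∈ pathEdge g i then c i else 0) =
        ∑ i ∈ Finset.range (2 * N + 1), (if x ∈ pathEdge g i then (k i : ℝ) else 0) := fun x =>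
      Finset.sum_congr rfl fun i hi => by rw [hk i (Finset.mem_range.1 hi)]
    obtain ⟨w₁, hw₁, hw₁s⟩ := h.exists_nat wE
      (fun e he => by
        have := hw e (Finset.mem_union_left _ he)
        simp only [hwE]
        split_ifs <;> linarith)
      (fun x => by
        obtain ⟨z, hz⟩ := hz x
        rw [hshift, hsumk] at hz
        refine ⟨z - ∑ i ∈ Finset.range (2 * N + 1), if x ∈ pathEdge g i then (k i : ℤ) else 0, ?_⟩
        push_cast
        linarith)
    obtain ⟨w₂, hw₂, hw₂k⟩ := exists_extend_along_path hg hpE w₁ k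
    refine ⟨w₂, fun A hA => ?_, fun x => ?_⟩
    · rcases List.mem_cons.1 hA with rfl | hA
      · refine ⟨pathEdge g (2 * i₀), Finset.mem_image.2 ⟨i₀, by simpa using hi₀, rfl⟩, ?_⟩
        rw [hw₂k _ (by omega)]
        have := hk (2 * i₀) (by omega)
        rw [hci₀] at this
        exact_mod_cast this.symm
      · obtain ⟨a, ha, ha0⟩ := hw₁ A hA
        exact ⟨a, ha, by rw [hw₂ a ((h.subset_nonempty A hA).1 ha), ha0]⟩
    · rw [hshift, hsumk, ← hw₁s, vertexSum_union_path hg hpE]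
      congr 1
      · exact vertexSum_congr (fun e he => by rw [hw₂ e he]) x
      · exact Finset.sum_congr rfl fun i hi => by rw [hw₂k i (Finset.mem_range.1 hi)]
  · intro w w' hw hw' hs
    have hstep : ∀ i, i + 1 < 2 * N + 1 → w (pathEdge g i) + w (pathEdge g (i + 1)) =
        w' (pathEdge g i) + w' (pathEdge g (i + 1)) := by
      intro i hi
      have := hs (g (i + 1))
      rwa [vertexSum_union_path hg hpE, vertexSum_union_path hg hpE,
        vertexSum_eq_zero (hE (i + 1) (by omega) hi),
        vertexSum_eq_zero (hE (i + 1) (by omega) hi),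
        sum_path_interior hg hi (fun i => w (pathEdge g i)),
        sum_path_interior hg hi (fun i => w' (pathEdge g i)), zero_add, zero_add] at this
    -- Equal sums at interior vertices force `w - w'` to alternate in sign along the path, hence to
    -- be constant on the even edges.
    have halt : ∀ i < 2 * N + 1, (w (pathEdge g i) : ℤ) - w' (pathEdge g i) =
        (-1) ^ i * ((w (pathEdge g 0) : ℤ) - w' (pathEdge g 0)) := by
      intro i
      induction i with
      | zero => simp
      | succ i ih =>
        intro hi
        have h1 := ih (by omega)
        have h2 := hstep i hi
        rw [pow_succ, mul_neg_one, neg_mul, ← h1]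
        omega
    have heven : ∀ j < N + 1, (w (pathEdge g (2 * j)) : ℤ) - w' (pathEdge g (2 * j)) =
        w (pathEdge g 0) - w' (pathEdge g 0) := by
      intro j hj
      rw [halt (2 * j) (by omega), pow_mul]
      norm_num
    have hzero : (w (pathEdge g 0) : ℤ) - w' (pathEdge g 0) = 0 := by
      -- A zero of `w` on an even edge makes this constant nonpositive, and a zero of `w'` makes it
      -- nonnegative.
      obtain ⟨a, ha, ha0⟩ := hw _ List.mem_cons_self
      obtain ⟨b, hb, hb0⟩ := hw' _ List.mem_cons_self
      obtain ⟨i, hi, rfl⟩ := Finset.mem_image.1 ha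
      obtain ⟨j, hj, rfl⟩ := Finset.mem_image.1 hb
      have h1 := heven i (Finset.mem_range.1 hi)
      have h2 := heven j (Finset.mem_range.1 hj)
      omega
    have hP : ∀ i < 2 * N + 1, w (pathEdge g i) = w' (pathEdge g i) := by
      intro i hi
      have := halt i hi
      rw [hzero, mul_zero] at this
      omega
    have hEq := h.unique w w' (fun A hA => hw A (by simp [hA])) (fun A hA => hw' A (by simp [hA]))
      (fun x => by
        have := hs x
        rw [vertexSum_union_path hg hpE, vertexSum_union_path hg hpE,
          Finset.sum_congr rfl fun i hi => by rw [hP i (Finset.mem_range.1 hi)]] at this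
        exact Nat.add_right_cancel this)
    intro e he
    rcases Finset.mem_union.1 he with he | he
    · exact hEq e he
    · obtain ⟨i, hi, rfl⟩ := Finset.mem_image.1 he
      exact hP i (Finset.mem_range.1 hi)

/-! ### From polygon trees to reduced weights. -/

lemma IsPolygon.exists_path {V : Type*} {G : SimpleGraph V} {C : G.Subgraph} {k : ℕ}
    (hC : IsPolygon C k) (hk : Even k) {u v : V} (huv : C.Adj u v) :
    ∃ (N : ℕ) (g : ℕ → V), 1 ≤ N ∧ k = 2 * N + 2 ∧ Set.InjOn g (Set.Iic (2 * N + 1)) ∧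
      g 0 = u ∧ g (2 * N + 1) = v ∧ (∀ i, g i ∈ C.verts) ∧
      ∀ e, e ∈ C.edgeSet ↔ e = s(u, v) ∨ ∃ i < 2 * N + 1, pathEdge g i = e := by
  classical
  obtain ⟨x, w, hw, hlen, rfl⟩ := hC
  have hu : u ∈ w.support := w.mem_verts_toSubgraph.1 huv.fst_mem
  -- Rotate the cycle to start at `u`, and reverse it if necessary so that `uv` is its last edge;
  -- the rest is a path from `u` to `v`.
  obtain ⟨c, hc, hcl, hcs, hcv⟩ : ∃ c : G.Walk u u, c.IsCycle ∧ c.length = k ∧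
      c.toSubgraph = w.toSubgraph ∧ c.penultimate = v := by
    have hadj : v ∈ (w.rotate u hu).toSubgraph.neighborSet u := by
      rw [SimpleGraph.Walk.toSubgraph_rotate]; exact huv
    rw [(hw.rotate hu).neighborSet_toSubgraph_endpoint] at hadj
    rcases hadj with h | h
    · refine ⟨(w.rotate u hu).reverse, (hw.rotate hu).reverse, by simp [hlen], by simp, ?_⟩
      rw [SimpleGraph.Walk.penultimate_reverse]
      exact h.symm
    · exact ⟨w.rotate u hu, hw.rotate hu, by simp [hlen], by simp, h.symm⟩
  have h3 := hc.three_le_length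
  obtain ⟨M, hM⟩ := hk
  obtain ⟨N, rfl⟩ : ∃ N, M = N + 1 := ⟨M - 1, by omega⟩
  have hcl' : c.length = 2 * N + 2 := by omega
  have hlast : c.getVert (2 * N + 1) = v := by
    rw [← hcv, SimpleGraph.Walk.penultimate, hcl']
    rfl
  have hend : c.getVert (2 * N + 2) = u := by rw [← hcl', SimpleGraph.Walk.getVert_length]
  refine ⟨N, c.getVert, by omega, by omega, ?_, by simp, hlast, fun i => ?_, fun e => ?_⟩
  · refine hc.getVert_injOn'.mono fun i hi => ?_
    simp only [Set.mem_Iic] at hi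
    change i ≤ c.length - 1
    omega
  · rw [← hcs, SimpleGraph.Walk.mem_verts_toSubgraph]
    exact c.getVert_mem_support i
  · induction e using Sym2.ind with | _ a b
    rw [← hcs, SimpleGraph.Subgraph.mem_edgeSet, SimpleGraph.Walk.toSubgraph_adj_iff]
    constructor
    · rintro ⟨i, hi, hil⟩
      rcases Nat.lt_or_ge i (2 * N + 1) with h | h
      · exact Or.inr ⟨i, h, hi⟩
      · obtain rfl : i = 2 * N + 1 := by omega
        left
        rw [← hi, hlast, hend, Sym2.eq_swap]
    · rintro (h | ⟨i, hi, h⟩)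
      · exact ⟨2 * N + 1, by rw [hlast, hend, h, Sym2.eq_swap], by omega⟩
      · exact ⟨i, h, by omega⟩

lemma IsPolygon.exists_adj {V : Type*} {G : SimpleGraph V} {C : G.Subgraph} {k : ℕ}
    (hC : IsPolygon C k) : ∃ u v, C.Adj u v := by
  obtain ⟨x, w, hw, -, rfl⟩ := hC
  exact ⟨_, _, w.toSubgraph_adj_snd hw.not_nil⟩

theorem IsPolygonTree.exists_hasReducedWeights {V : Type*} [DecidableEq V] {G : SimpleGraph V}
    {H : G.Subgraph} {s : Multiset ℕ} (h : IsPolygonTree H s) (hs : ∀ k ∈ s, Even k) :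
    ∃ (E : Finset (Sym2 V)) (L : List (Finset (Sym2 V))), HasReducedWeights E L ∧
      (∀ e, e ∈ E ↔ e ∈ H.edgeSet) ∧ (L.map Finset.card).sum = (s.map (· / 2)).sum := by
  induction h with
  | @polygon C k hC =>
    obtain ⟨u, v, huv⟩ := hC.exists_adj
    obtain ⟨N, g, hN, rfl, hg, rfl, rfl, -, hedge⟩ := hC.exists_path (hs k (by simp)) huv
    -- The initial polygon is treated as glued onto a single edge, so it too contributes half its
    -- edges to `L`.
    refine ⟨_, _, (hasReducedWeights_singleton s(g 0, g (2 * N + 1))).glue hN hg ?_ (by simp),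
      fun e => ?_, ?_⟩
    · intro i hi hi' e he h
      obtain rfl := Finset.mem_singleton.1 he
      rcases Sym2.mem_iff.1 h with h | h
      · have := hg (by simp; omega) (by simp) h
        omega
      · have := hg (by simp; omega) (by simp) h
        omega
    · rw [hedge]; simp
    · simp [card_image_pathEdge_even hg]
  | @glue H C s k u v hH hC huvH huvC hverts ih =>
    obtain ⟨E, L, hEL, hE, hL⟩ := ih fun k hk => hs k (by simp [hk])
    obtain ⟨N, g, hN, rfl, hg, rfl, rfl, hgC, hedge⟩ := hC.exists_path (hs k (by simp)) huvC
    refine ⟨_, _, hEL.glue hN hg ?_ ((hE _).2 huvH), fun e => ?_, ?_⟩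
    · intro i hi hi' e he h
      have hmem : g i ∈ H.verts ∩ C.verts :=
        ⟨H.mem_verts_of_mem_edge ((hE e).1 he) h, hgC i⟩
      rw [hverts] at hmem
      rcases hmem with h | h
      · have := hg (by simp; omega) (by simp) h
        omega
      · have := hg (by simp; omega) (by simp) h
        omega
    · rw [SimpleGraph.Subgraph.edgeSet_sup, Set.mem_union, hedge, Finset.mem_union, hE]
      have : s(g 0, g (2 * N + 1)) ∈ H.edgeSet := huvH
      simp only [Finset.mem_image, Finset.mem_range]
      constructor
      · tauto
      · rintro (h | rfl | h) <;> tauto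
    · simp [card_image_pathEdge_even hg, hL]

/-! ### Lattice points of dilated edge polytopes. -/

lemma edgeVector_apply {V : Type*} [DecidableEq V] {e : Sym2 V} (he : ¬ e.IsDiag) (x : V) :
    edgeVector e x = if x ∈ e then 1 else 0 := by
  induction e using Sym2.ind with | _ a b
  have hab : a ≠ b := by simpa using he
  simp only [edgeVector, Sym2.lift_mk, Pi.add_apply, Pi.single_apply, Sym2.mem_iff]
  by_cases h1 : x = a
  · subst h1; simp [hab]
  · by_cases h2 : x = b <;> simp [h1, h2, hab.symm]

lemma sum_smul_edgeVector {V : Type*} [DecidableEq V] {E : Finset (Sym2 V)}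
    (hE : ∀ e ∈ E, ¬ e.IsDiag) (w : Sym2 V → ℝ) :
    ∑ e ∈ E, w e • edgeVector e = vertexSum E w := by
  funext x
  rw [Finset.sum_apply, vertexSum]
  refine Finset.sum_congr rfl fun e he => ?_
  simp [edgeVector_apply (hE e he)]

lemma sum_vertexSum {V : Type*} [Fintype V] [DecidableEq V] {E : Finset (Sym2 V)}
    (hE : ∀ e ∈ E, ¬ e.IsDiag) (w : Sym2 V → ℝ) :
    ∑ x, vertexSum E w x = 2 * ∑ e ∈ E, w e := by
  simp only [vertexSum]
  rw [Finset.sum_comm, Finset.mul_sum]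
  refine Finset.sum_congr rfl fun e he => ?_
  have hdiag := hE e he
  induction e using Sym2.ind with | _ a b
  have hab : a ≠ b := by simpa using hdiag
  have : Finset.univ.filter (fun x => x ∈ s(a, b)) = {a, b} := by ext; simp
  rw [← Finset.sum_filter, this, Finset.sum_pair hab, two_mul]

lemma mem_edgePolytope_iff {V : Type*} [DecidableEq V] {G : SimpleGraph V} {E : Finset (Sym2 V)}
    (hE : ∀ e, e ∈ E ↔ e ∈ G.edgeSet) {y : V → ℝ} :
    y ∈ edgePolytope G ↔ ∃ w : Sym2 V → ℝ, (∀ e ∈ E, 0 ≤ w e) ∧ ∑ e ∈ E, w e = 1 ∧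
      vertexSum E w = y := by
  have hdiag : ∀ e ∈ E, ¬ e.IsDiag := fun e he => G.not_isDiag_of_mem_edgeSet ((hE e).1 he)
  constructor
  · intro hy
    have hconv : Convex ℝ {y : V → ℝ | ∃ w : Sym2 V → ℝ, (∀ e ∈ E, 0 ≤ w e) ∧
        ∑ e ∈ E, w e = 1 ∧ ∑ e ∈ E, w e • edgeVector e = y} := by
      rintro _ ⟨w₁, h₁, hs₁, rfl⟩ _ ⟨w₂, h₂, hs₂, rfl⟩ a b ha hb hab
      refine ⟨fun e => a * w₁ e + b * w₂ e, fun e he => ?_, ?_, ?_⟩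
      · have := h₁ e he
        have := h₂ e he
        positivity
      · rw [Finset.sum_add_distrib, ← Finset.mul_sum, ← Finset.mul_sum, hs₁, hs₂]
        linarith
      · simp only [add_smul, mul_smul, Finset.sum_add_distrib, Finset.smul_sum]
    obtain ⟨w, h1, h2, h3⟩ := convexHull_min (by
      rintro _ ⟨e, he, rfl⟩
      have he' := (hE e).2 he
      refine ⟨fun e' => if e' = e then 1 else 0, fun e' _ => ?_, ?_, ?_⟩
      · dsimp only; split_ifs <;> norm_num
      · simp [he']
      · simp [ite_smul, he']) hconv hy
    exact ⟨w, h1, h2, by rw [← h3, sum_smul_edgeVector hdiag]⟩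
  · rintro ⟨w, h1, h2, rfl⟩
    rw [← sum_smul_edgeVector hdiag]
    exact (convex_convexHull ℝ _).sum_mem h1 h2 fun e he =>
      subset_convexHull ℝ _ ⟨e, (hE e).1 he, rfl⟩

lemma vertexSum_mul_left {V : Type*} [DecidableEq V] (E : Finset (Sym2 V)) (c : ℝ)
    (w : Sym2 V → ℝ) : vertexSum E (fun e => c * w e) = c • vertexSum E w := by
  funext x
  simp [vertexSum, Finset.mul_sum]

lemma mem_smul_edgePolytope_iff {V : Type*} [DecidableEq V] {G : SimpleGraph V}
    {E : Finset (Sym2 V)} (hE : ∀ e, e ∈ E ↔ e ∈ G.edgeSet) (hne : E.Nonempty) {m : ℕ}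
    {y : V → ℝ} :
    y ∈ (m : ℝ) • edgePolytope G ↔ ∃ w : Sym2 V → ℝ, (∀ e ∈ E, 0 ≤ w e) ∧
      ∑ e ∈ E, w e = m ∧ vertexSum E w = y := by
  constructor
  · rintro ⟨z, hz, rfl⟩
    obtain ⟨w, h1, h2, rfl⟩ := (mem_edgePolytope_iff hE).1 hz
    exact ⟨fun e => m * w e, fun e he => mul_nonneg m.cast_nonneg (h1 e he),
      by rw [← Finset.mul_sum, h2, mul_one], vertexSum_mul_left E m w⟩
  · rintro ⟨w, h1, h2, rfl⟩
    rcases Nat.eq_zero_or_pos m with rfl | hm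
    -- The zeroth dilate is `{0}` only because the polytope is nonempty, so some edge must be
    -- supplied.
    · have h0 : ∀ e ∈ E, w e = 0 := by
        rw [Nat.cast_zero] at h2
        exact (Finset.sum_eq_zero_iff_of_nonneg h1).1 h2
      obtain ⟨e, he⟩ := hne
      refine ⟨edgeVector e, subset_convexHull ℝ _ ⟨e, (hE e).1 he, rfl⟩, ?_⟩
      funext x
      rw [vertexSum_congr (w' := fun _ => 0) h0]
      simp [vertexSum]
    · have hm' : (m : ℝ) ≠ 0 := by positivity
      refine ⟨vertexSum E (fun e => (m : ℝ)⁻¹ * w e), (mem_edgePolytope_iff hE).2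
        ⟨_, fun e he => mul_nonneg (by positivity) (h1 e he), ?_, rfl⟩, ?_⟩
      · rw [← Finset.mul_sum, h2, inv_mul_cancel₀ hm']
      · simp only
        rw [vertexSum_mul_left, smul_inv_smul₀ hm']

lemma natCast_vertexSum {V : Type*} [DecidableEq V] (E : Finset (Sym2 V)) (w : Sym2 V → ℕ)
    (x : V) : ((vertexSum E w x : ℕ) : ℝ) = vertexSum E (fun e => (w e : ℝ)) x := by
  simp [vertexSum]

theorem HasReducedWeights.ehrhartCount_eq {V : Type*} [Fintype V] [DecidableEq V]
    {G : SimpleGraph V} {E : Finset (Sym2 V)} {L : List (Finset (Sym2 V))}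
    (h : HasReducedWeights E L) (hE : ∀ e, e ∈ E ↔ e ∈ G.edgeSet) (m : ℕ) :
    ehrhartCount G m = (reducedWeights E L m).card := by
  have hdiag : ∀ e ∈ E, ¬ e.IsDiag := fun e he => G.not_isDiag_of_mem_edgeSet ((hE e).1 he)
  have hne : E.Nonempty := Finset.card_pos.1 (by have := h.sum_card_lt; omega)
  have himage : {x : V → ℤ | (fun v => (x v : ℝ)) ∈ (m : ℝ) • edgePolytope G} =
      (fun (w : Sym2 V → ℕ) (v : V) => ((vertexSum E w v : ℕ) : ℤ)) ''
        (reducedWeights E L m : Set (Sym2 V → ℕ)) := by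
    ext x
    rw [Set.mem_ofPred_eq, mem_smul_edgePolytope_iff hE hne]
    constructor
    · rintro ⟨w, hw0, hws, hwx⟩
      obtain ⟨w₁, hw₁, hw₁s⟩ := h.exists_nat w hw0 fun v => ⟨x v, congrFun hwx v⟩
      have hcongr : ∀ v, vertexSum E (fun e => if e ∈ E then w₁ e else 0) v = vertexSum E w₁ v :=
        vertexSum_congr fun e he => by simp [he]
      -- Members of `reducedWeights` are supported on `E`, while `w₁` is unconstrained outside it.
      refine ⟨fun e => if e ∈ E then w₁ e else 0, ?_, ?_⟩
      · rw [Finset.mem_coe, mem_reducedWeights]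
        refine ⟨⟨?_, fun e he => by_contra fun h => he (by simp [h])⟩, fun A hA => ?_⟩
        -- The total weight is half the sum of all vertex sums, so reduction preserves it.
        · have h1 := sum_vertexSum hdiag w
          have h2 := sum_vertexSum hdiag fun e => (w₁ e : ℝ)
          simp only [hw₁s] at h2
          have h3 : ∑ e ∈ E, (w₁ e : ℝ) = m := by linarith
          rw [Finset.sum_congr rfl fun e he => if_pos he]
          exact_mod_cast h3
        · obtain ⟨a, ha, ha0⟩ := hw₁ A hA
          exact ⟨a, ha, by simp [ha0]⟩
      · funext v
        have h1 := hw₁s v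
        rw [hwx, ← natCast_vertexSum] at h1
        simp only [hcongr]
        change ((vertexSum E w₁ v : ℕ) : ℝ) = (x v : ℝ) at h1
        exact_mod_cast h1
    · rintro ⟨w, hw, rfl⟩
      rw [Finset.mem_coe, mem_reducedWeights] at hw
      refine ⟨fun e => w e, fun e _ => (w e).cast_nonneg, by rw [← hw.1.1, Nat.cast_sum], ?_⟩
      funext v
      rw [← natCast_vertexSum]
      simp
  rw [ehrhartCount, himage, Set.InjOn.ncard_image, Set.ncard_coe_finset]
  intro w hw w' hw' heq
  rw [Finset.mem_coe, mem_reducedWeights] at hw hw'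
  have hu := h.unique w w' hw.2 hw'.2 fun v => by simpa using congrFun heq v
  funext e
  by_cases he : e ∈ E
  · exact hu e he
  · rw [by_contra fun h => he (hw.1.2 e h), by_contra fun h => he (hw'.1.2 e h)]

/-! ### Polygon multiplicities and the final assembly. -/

lemma sum_map_half_eq {s : Multiset ℕ} (hs : ∀ k ∈ s, Even k) {f : ℕ →₀ ℕ}
    (hf : ∀ n, f n = s.count (2 * n)) : f.sum (fun n c => n * c) = (s.map (· / 2)).sum := by
  have hcount : ∀ n, f n = (s.map (· / 2)).count n := by
    intro n
    have hdouble : (s.map (· / 2)).map (2 * ·) = s := by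
      rw [Multiset.map_map]
      conv_rhs => rw [← Multiset.map_id s]
      exact Multiset.map_congr rfl fun k hk => Nat.two_mul_div_two_of_even (hs k hk)
    rw [hf]
    conv_lhs => rw [← hdouble]
    exact Multiset.count_map_eq_count' _ _ (mul_right_injective₀ two_ne_zero) _
  rw [Finset.sum_multiset_count, Finsupp.sum]
  have hsupp : f.support = (s.map (· / 2)).toFinset := by
    ext n
    rw [Finsupp.mem_support_iff, hcount, Multiset.mem_toFinset, Multiset.count_ne_zero]
  rw [hsupp]
  exact Finset.sum_congr rfl fun n _ => by rw [← hcount, smul_eq_mul, mul_comm]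

lemma root_of_mem_rootSet {a : ℤ} {p : Polynomial ℂ} (hp : p ∈ rootSet a) {z : ℂ}
    (hz : p.IsRoot z) : (∃ k : ℤ, k < 0 ∧ z = (k : ℂ)) ∨ z.re = -((a : ℝ) + 1) / 2 := by
  obtain ⟨-, v, rfl, hv⟩ := hp
  rw [Polynomial.IsRoot, Polynomial.eval_mul, mul_eq_zero, Polynomial.eval_prod,
    Finset.prod_eq_zero_iff] at hz
  rcases hz with h | ⟨i, hi, h⟩
  · exact Or.inr (hv z h)
  · rw [Finset.mem_Icc] at hi
    refine Or.inl ⟨-i, by omega, ?_⟩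
    push_cast
    exact eq_neg_of_add_eq_zero_left (by simpa using h)

theorem proposition4p6 {V : Type*} [Fintype V] [DecidableEq V] (G : SimpleGraph V)
    (f : ℕ →₀ ℕ) (hG : IsBipartitePolygonTree G f) :
    ∃ p : Polynomial ℚ, IsEhrhartPolynomial G p ∧
      p.map (algebraMap ℚ ℂ) ∈
        rootSet ((G.edgeSet.ncard : ℤ) - 1 - f.sum (fun n c => (n : ℤ) * (c : ℤ))) ∧
      ∀ z : ℂ, Polynomial.aeval z p = 0 →
        (∃ k : ℤ, k < 0 ∧ z = (k : ℂ)) ∨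
        z.re = -((G.edgeSet.ncard : ℝ) - f.sum (fun n c => (n : ℝ) * (c : ℝ))) / 2 := by
  obtain ⟨s, hs, heven, hf⟩ := hG
  obtain ⟨E, L, hEL, hE, hL⟩ := hs.exists_hasReducedWeights heven
  rw [SimpleGraph.Subgraph.edgeSet_top] at hE
  have hcard : G.edgeSet.ncard = E.card := by
    rw [← Set.ncard_coe_finset]
    congr 1
    ext e
    exact (hE e).symm
  have hsum := sum_map_half_eq heven hf
  have hsumZ : f.sum (fun n c => (n : ℤ) * (c : ℤ)) = (L.map Finset.card).sum := by
    rw [hL, ← hsum, Finsupp.sum, Finsupp.sum]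
    push_cast
    rfl
  have hsumR : f.sum (fun n c => (n : ℝ) * (c : ℝ)) = (L.map Finset.card).sum := by
    rw [hL, ← hsum, Finsupp.sum, Finsupp.sum]
    push_cast
    rfl
  obtain ⟨p, hp, hpm⟩ := exists_polynomial_card_reducedWeights hEL.subset_nonempty
    hEL.pairwise_disjoint hEL.sum_card_lt
  rw [hsumZ, hsumR, hcard]
  refine ⟨p, fun m => ?_, hp, fun z hz => ?_⟩
  · rw [hpm, hEL.ehrhartCount_eq hE]
  · have hroot : (p.map (algebraMap ℚ ℂ)).IsRoot z := by
      rwa [Polynomial.IsRoot, Polynomial.eval_map_algebraMap]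
    refine (root_of_mem_rootSet hp hroot).imp_right fun h => ?_
    rw [h, Int.cast_sub, Int.cast_sub, Int.cast_natCast, Int.cast_natCast, Int.cast_one]
    ring
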